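/- Let $k \ge 0$. A property of $k$-tuples of positive integers is said to have probability $x$ if the proportion of the $n^k$ tuples $(a_1,\dots,a_k)$ with $1 \le a_1,\dots,a_k \le n$ that have the property tends to $x$ as $n \to \infty$. For a simple graph $G$ with vertex set $\{1,\dots,k\}$, let $i_m(G)$ denote the number of independent sets of $G$ with exactly $m$ vertices, and put $$A_G = \prod_{p \text{ prime}} \left( \sum_{m=0}^{k} i_m(G) \left(1-\frac1p\right)^{k-m} \frac{1}{p^m} \right), \qquad B_{k,i} = \sum_{G:\ |E(G)| = i} A_G ,$$ the last sum being over all simple graphs on the labeled vertex set $\{1,\dots,k\}$ with exactly $i$ edges. The product $A_G$ converges unconditionally, and $A_G$ is the probability that $k$ positive integers $a_1,\dots,a_k$ are $G$-wise relatively prime, that is, $\gcd(a_i,a_j)=1$ for every edge $\{i,j\}$ of $G$. Moreover: 1. For every integer $r \ge 0$, the probability that exactly $r$ of the pairs $\{a_i,a_j\}$ with $i<j$ are relatively prime is $$A_{k,=r} = \sum_{i=r}^{k(k-1)/2} (-1)^{i-r} \binom{i}{r} B_{k,i}.$$ 2. For every integer $r \ge 1$, the probability that at least $r$ of these pairs are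 relatively prime is $$A_{k,\ge r} = \sum_{i=r}^{k(k-1)/2} (-1)^{i-r} \binom{i-1}{r-1} B_{k,i}.$$ 3. In particular, the probability that $a_1,\dots,a_k$ are pairwise not relatively prime is $$A_{k,=0} = \sum_{i=0}^{k(k-1)/2} (-1)^{i} B_{k,i}.$$ -/

import Mathlib

open Filter Topology

/-- The number of `k`-tuples of positive integers `a` with `1 ≤ a i ≤ n` for all `i` that have the
property `P`. -/
noncomputable def tupleCount (k : ℕ) (P : (Fin k → ℕ) → Prop) (n : ℕ) : ℕ := by
  classical
  exact ((Fintype.piFinset fun _ : Fin k => Finset.Icc 1 n).filter P).card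

/-- "The probability that `k` positive integers have the property `P` is `x`": the proportion of
the `n ^ k` tuples with entries in `{1, …, n}` that have the property tends to `x` as `n → ∞`. -/
def HasProbability (k : ℕ) (P : (Fin k → ℕ) → Prop) (x : ℝ) : Prop :=
  Tendsto (fun n : ℕ => (tupleCount k P n : ℝ) / (n : ℝ) ^ k) atTop (𝓝 x)

/-- The tuple `a` is `G`-wise relatively prime. -/
def IsGraphwiseCoprime {k : ℕ} (G : SimpleGraph (Fin k)) (a : Fin k → ℕ) : Prop :=
  ∀ i j : Fin k, G.Adj i j → Nat.Coprime (a i) (a j)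

/-- The number of pairs of indices `i < j` such that `a i` and `a j` are relatively prime. -/
def coprimePairs {k : ℕ} (a : Fin k → ℕ) : ℕ :=
  ((Finset.univ : Finset (Fin k × Fin k)).filter
    fun e => e.1 < e.2 ∧ Nat.Coprime (a e.1) (a e.2)).card

/-- The number `i_m(G)` of independent sets of cardinality `m` in `G`. -/
noncomputable def indepCount {k : ℕ} (G : SimpleGraph (Fin k)) (m : ℕ) : ℕ :=
  {s : Finset (Fin k) | G.IsNIndepSet m s}.ncard

/-- The Euler factor at `p` in the product `A_G`. -/
noncomputable def eulerFactor {k : ℕ} (G : SimpleGraph (Fin k)) (p : Nat.Primes) : ℝ :=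
  ∑ m ∈ Finset.range (k + 1),
    (indepCount G m : ℝ) * (1 - 1 / ((p : ℕ) : ℝ)) ^ (k - m) * (1 / ((p : ℕ) : ℝ) ^ m)

/-- The Euler product `A_G`. -/
noncomputable def graphConst {k : ℕ} (G : SimpleGraph (Fin k)) : ℝ :=
  ∏' p : Nat.Primes, eulerFactor G p

/-- `B_{k,i}`, the sum of `A_G` over all graphs `G` with vertex set `Fin k` and `i` edges. -/
noncomputable def graphConstSum (k i : ℕ) : ℝ := by
  classical
  exact ∑ G ∈ (Finset.univ : Finset (SimpleGraph (Fin k))).filter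
    (fun G => G.edgeSet.ncard = i), graphConst G

/-! Modulo a prime p, the vanishing entries of a random residue tuple form a given set s with
probability (1 - 1/p)^(k - |s|) / p^|s|, and p divides no two adjacent entries exactly when s is
independent. So the Euler factor is the local probability at p (`eulerFactor_eq_card_div`), and by
the Chinese remainder theorem finitely many primes act independently (`hasProbability_forall_cast`).

To reach all primes, note that p divides both ends of a fixed edge for a proportion at most 1/p^2 of
the tuples, uniformly in n. Primes outside a large finite set therefore cost at most k^2 times a
tail of ∑ 1/p^2 (`tupleCount_isGraphwiseCoprimeAt_le`). The analogous count modulo p shows that the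
factors differ from 1 by at most k^2/p^2, so the product converges.

For the number e of coprime pairs of a tuple, G-wise coprimality means that G lies in a graph with e
edges, so exactly `e.choose i` graphs with i edges qualify. Hence B_{k,i} is the limiting mean of
`e.choose i`, and it remains to write the indicators of e = r and e ≥ r as integer combinations of
these binomials. -/

open Filter Topology

/-! ### Densities of congruence conditions -/

/-- Residue classes modulo `N` have natural density `1 / N`. -/
theorem tendsto_card_Icc_modEq_div {N : ℕ} (hN : 0 < N) (v : ℕ) :
    Tendsto (fun n : ℕ => (((Finset.Icc 1 n).filter (· ≡ v [MOD N])).card : ℝ) / n) atTop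
      (𝓝 (1 / N)) := by
  have hN' : (0 : ℝ) < N := by exact_mod_cast hN
  -- The count is a difference of two floors, each off by less than 1.
  have hbound : ∀ n : ℕ,
      |(((Finset.Icc 1 n).filter (· ≡ v [MOD N])).card : ℝ) - n / N| ≤ 2 := by
    intro n
    have h := Nat.Ioc_filter_modEq_card 0 n hN v
    have e : Finset.Ioc 0 n = Finset.Icc 1 n := by ext; simp [Nat.succ_le_iff]
    rw [e] at h
    have hmono : ⌊(((0 : ℕ) : ℚ) - v) / N⌋ ≤ ⌊((n : ℚ) - v) / N⌋ := by
      apply Int.floor_mono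
      gcongr
      simp
    rw [max_eq_left (by linarith)] at h
    have h' : (((Finset.Icc 1 n).filter (· ≡ v [MOD N])).card : ℚ) =
        ⌊((n : ℚ) - v) / N⌋ - ⌊(((0 : ℕ) : ℚ) - v) / N⌋ := by exact_mod_cast h
    have hq : |(((Finset.Icc 1 n).filter (· ≡ v [MOD N])).card : ℚ) - n / N| ≤ 2 := by
      rw [h']
      have h1 := Int.floor_le (((n : ℚ) - v) / N)
      have h2 := Int.lt_floor_add_one (((n : ℚ) - v) / N)
      have h3 := Int.floor_le ((((0 : ℕ) : ℚ) - v) / N)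
      have h4 := Int.lt_floor_add_one ((((0 : ℕ) : ℚ) - v) / N)
      rw [sub_div] at h1 h2 h3 h4
      simp only [Nat.cast_zero, zero_div, sub_div] at *
      rw [abs_le]
      constructor <;> linarith
    have hr : (((|(((Finset.Icc 1 n).filter (· ≡ v [MOD N])).card : ℚ) - n / N| : ℚ)) : ℝ) ≤
        ((2 : ℚ) : ℝ) := by exact_mod_cast hq
    push_cast at hr
    exact hr
  rw [tendsto_iff_norm_sub_tendsto_zero]
  refine squeeze_zero' (.of_forall fun _ => norm_nonneg _) ?_
    (tendsto_const_div_atTop_nhds_zero_nat 2)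
  filter_upwards [eventually_gt_atTop 0] with n hn
  have hn' : (0 : ℝ) < n := by exact_mod_cast hn
  rw [Real.norm_eq_abs, le_div_iff₀ hn', ← abs_of_pos hn', ← abs_mul, abs_of_pos hn']
  rw [sub_mul, div_mul_cancel₀ _ hn'.ne', one_div_mul_eq_div]
  exact hbound n

/-- Simultaneous congruence conditions modulo pairwise coprime moduli have density the product of
the reciprocals of the moduli. -/
theorem tendsto_card_Icc_forall_cast_eq_div {ι : Type*} [Fintype ι] (q : ι → ℕ)
    [∀ i, NeZero (q i)] (hq : Pairwise (Function.onFun Nat.Coprime q)) (c : ∀ i, ZMod (q i)) :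
    Tendsto (fun n : ℕ =>
      (((Finset.Icc 1 n).filter fun x : ℕ => ∀ i, (x : ZMod (q i)) = c i).card : ℝ) / n) atTop
      (𝓝 (1 / ((∏ i, q i : ℕ) : ℝ))) := by
  have hpos : 0 < ∏ i, q i := Finset.prod_pos fun i _ => NeZero.pos (q i)
  have : NeZero (∏ i, q i) := ⟨hpos.ne'⟩
  let e := ZMod.prodEquivPi q hq
  refine (tendsto_card_Icc_modEq_div hpos (e.symm c).val).congr fun n => ?_
  congr 3
  refine Finset.filter_congr fun x _ => ?_
  rw [← ZMod.natCast_eq_natCast_iff, ZMod.natCast_zmod_val, ← e.injective.eq_iff,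
    e.apply_symm_apply, map_natCast, funext_iff]
  rfl

theorem tupleCount_eq_card (k : ℕ) (P : (Fin k → ℕ) → Prop) [DecidablePred P] (n : ℕ) :
    tupleCount k P n = ((Fintype.piFinset fun _ : Fin k => Finset.Icc 1 n).filter P).card := by
  rw [tupleCount]
  congr

open Classical in
/-- Conditions modulo pairwise coprime moduli are independent: the probability that all of them
hold is the product of the proportions of admissible residue tuples. -/
theorem hasProbability_forall_cast {ι : Type*} [Fintype ι] (q : ι → ℕ) [∀ i, NeZero (q i)]
    (hq : Pairwise (Function.onFun Nat.Coprime q)) (k : ℕ)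
    (Q : ∀ i, (Fin k → ZMod (q i)) → Prop) :
    HasProbability k (fun a => ∀ i, Q i fun j => (a j : ZMod (q i)))
      (∏ i, ((Finset.univ.filter (Q i)).card : ℝ) / (q i : ℝ) ^ k) := by
  -- Once the residues of every entry are fixed, the entries are unconstrained by each other, so the
  -- count is a sum over S of products of one-variable counts.
  let S : Finset (Fin k → ∀ i, ZMod (q i)) :=
    Finset.univ.filter fun c => ∀ i, Q i fun j => c j i
  have hcount : ∀ n, tupleCount k (fun a => ∀ i, Q i fun j => (a j : ZMod (q i))) n =
      ∑ c ∈ S, ∏ j, ((Finset.Icc 1 n).filter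
        fun x : ℕ => ∀ i, (x : ZMod (q i)) = c j i).card := by
    intro n
    rw [tupleCount_eq_card, Finset.card_eq_sum_card_fiberwise
      (f := fun a j i => (a j : ZMod (q i))) (t := S)]
    · refine Finset.sum_congr rfl fun c hc => ?_
      rw [← Fintype.card_piFinset]
      congr 1
      ext a
      simp only [Finset.mem_filter, Fintype.mem_piFinset, funext_iff]
      simp only [S, Finset.mem_filter, Finset.mem_univ, true_and] at hc
      constructor
      · rintro ⟨⟨h1, -⟩, h2⟩ j
        exact ⟨h1 j, h2 j⟩
      · intro h
        refine ⟨⟨fun j => (h j).1, fun i => ?_⟩, fun j => (h j).2⟩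
        simpa only [(h _).2 i] using hc i
    · intro a ha
      simpa [S] using (Finset.mem_filter.1 ha).2
  have hS : S.card = ∏ i, (Finset.univ.filter (Q i)).card := by
    rw [← Fintype.card_piFinset]
    refine Finset.card_bij (fun c _ i j => c j i) ?_ ?_ ?_
    · intro c hc
      simpa [S] using hc
    · intro c _ d _ h
      ext j i
      exact congrFun (congrFun h i) j
    · intro b hb
      exact ⟨fun j i => b i j, by simpa [S] using hb, rfl⟩
  have hlim : Tendsto (fun n : ℕ => ∑ c ∈ S, ∏ j, ((((Finset.Icc 1 n).filter
        fun x : ℕ => ∀ i, (x : ZMod (q i)) = c j i).card : ℝ) / n)) atTop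
      (𝓝 (∑ _c ∈ S, ∏ _j : Fin k, 1 / ((∏ i, q i : ℕ) : ℝ))) :=
    tendsto_finsetSum _ fun c _ => tendsto_finsetProd _ fun j _ =>
      tendsto_card_Icc_forall_cast_eq_div q hq (c j)
  have hval : ∑ _c ∈ S, ∏ _j : Fin k, 1 / ((∏ i, q i : ℕ) : ℝ) =
      ∏ i, ((Finset.univ.filter (Q i)).card : ℝ) / (q i : ℝ) ^ k := by
    simp [hS, div_eq_mul_inv, Finset.prod_mul_distrib, Finset.prod_inv_distrib, Finset.prod_pow]
  rw [hval] at hlim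
  refine hlim.congr fun n => ?_
  rw [hcount]
  push_cast
  rw [Finset.sum_div]
  refine Finset.sum_congr rfl fun c _ => ?_
  simp [Finset.prod_div_distrib]

/-- Among the functions `ι → X`, the proportion of those with prescribed values in `T` at two
places is the square of the density of `T` in `X`. -/
theorem card_piFinset_filter_and_mul_sq {ι α : Type*} [Fintype ι] [DecidableEq ι]
    (X : Finset α) (T : α → Prop) [DecidablePred T] {i j : ι} (hij : i ≠ j) :
    ((Fintype.piFinset fun _ : ι => X).filter fun a => T (a i) ∧ T (a j)).card * X.card ^ 2 =
      (X.filter T).card ^ 2 * X.card ^ Fintype.card ι := by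
  have h : (Fintype.piFinset fun _ : ι => X).filter (fun a => T (a i) ∧ T (a j)) =
      Fintype.piFinset fun l => if l = i ∨ l = j then X.filter T else X := by
    ext a
    simp only [Finset.mem_filter, Fintype.mem_piFinset]
    constructor
    · rintro ⟨h1, h2, h3⟩ l
      split_ifs with hl
      · rcases hl with rfl | rfl <;> simp [*]
      · exact h1 l
    · intro h
      have hi := h i
      have hj := h j
      simp only [true_or, or_true, if_true, Finset.mem_filter] at hi hj
      refine ⟨fun l => ?_, hi.2, hj.2⟩
      have := h l
      split_ifs at this
      · exact (Finset.mem_filter.1 this).1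
      · exact this
  have hpair : (Finset.univ.filter fun l => l = i ∨ l = j).card = 2 := by
    rw [← Finset.card_pair hij]
    congr 1
    ext
    simp
  have hcard := Finset.card_filter_add_card_filter_not (s := (Finset.univ : Finset ι))
    (fun l => l = i ∨ l = j)
  rw [hpair, Finset.card_univ] at hcard
  rw [h, Fintype.card_piFinset, ← hcard]
  simp only [apply_ite Finset.card]
  rw [Finset.prod_ite, Finset.prod_const, Finset.prod_const, hpair, pow_add]
  ring

/-! ### Inclusion-exclusion identities -/

/-- Counting the `r`-subsets of an `e`-set by inclusion-exclusion. -/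
theorem sum_neg_one_pow_mul_choose_mul_choose (r e : ℕ) :
    ∑ i ∈ Finset.Icc r e, (-1 : ℤ) ^ (i - r) * i.choose r * e.choose i = if e = r then 1 else 0 := by
  rcases lt_or_ge e r with h | h
  · rw [Finset.Icc_eq_empty (by omega), if_neg (by omega), Finset.sum_empty]
  obtain ⟨d, rfl⟩ := Nat.exists_eq_add_of_le h
  have h1 : Finset.Icc r (r + d) = (Finset.range (d + 1)).image (r + ·) := by
    ext x
    simp only [Finset.mem_Icc, Finset.mem_image, Finset.mem_range]
    constructor
    · intro hx
      exact ⟨x - r, by omega, by omega⟩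
    · rintro ⟨y, hy, rfl⟩
      omega
  rw [h1, Finset.sum_image (by intro a _ b _ h; simpa using h)]
  have h2 : ∀ x ∈ Finset.range (d + 1),
      (-1 : ℤ) ^ (r + x - r) * (r + x).choose r * (r + d).choose (r + x) =
        (r + d).choose r * ((-1) ^ x * d.choose x) := by
    intro x hx
    rw [Finset.mem_range] at hx
    -- Trinomial revision leaves the alternating sum of a row of binomials, which vanishes unless d
    -- = 0.
    have h3 := Nat.choose_mul (n := r + d) (k := r + x) (s := r) (by omega)
    rw [Nat.add_sub_cancel_left, Nat.add_sub_cancel_left] at h3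
    have h4 : ((r + d).choose (r + x) : ℤ) * (r + x).choose r =
      (r + d).choose r * d.choose x := by exact_mod_cast h3
    rw [Nat.add_sub_cancel_left]
    linear_combination (-1) ^ x * h4
  rw [Finset.sum_congr rfl h2, ← Finset.mul_sum, Int.alternating_sum_range_choose]
  rcases eq_or_ne d 0 with rfl | hd
  · simp
  · simp [hd]

/-- The range of summation may be enlarged. -/
theorem sum_neg_one_pow_mul_choose_mul_choose_of_le {r e M : ℕ} (he : e ≤ M) :
    ∑ i ∈ Finset.Icc r M, (-1 : ℤ) ^ (i - r) * i.choose r * e.choose i = if e = r then 1 else 0 := by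
  rw [← sum_neg_one_pow_mul_choose_mul_choose]
  refine (Finset.sum_subset (Finset.Icc_subset_Icc_right he) fun i hi hi' => ?_).symm
  rw [Finset.mem_Icc] at hi hi'
  rw [Nat.choose_eq_zero_of_lt (by omega : e < i)]
  simp

/-- Induction on e: by Pascal's rule, passing from e to e + 1 adds the exact-count identity for r -
1, which contributes precisely when e = r - 1. -/
theorem sum_neg_one_pow_mul_choose_pred_mul_choose_of_le {r e M : ℕ} (hr : 1 ≤ r) (he : e ≤ M) :
    ∑ i ∈ Finset.Icc r M, (-1 : ℤ) ^ (i - r) * (i - 1).choose (r - 1) * e.choose i =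
      if r ≤ e then 1 else 0 := by
  obtain ⟨r, rfl⟩ := Nat.exists_eq_add_of_le' hr
  induction e with
  | zero =>
    rw [if_neg (by omega)]
    refine Finset.sum_eq_zero fun i hi => ?_
    rw [Finset.mem_Icc] at hi
    rw [Nat.choose_eq_zero_of_lt (by omega : 0 < i)]
    simp
  | succ e ih =>
    obtain ⟨M, rfl⟩ := Nat.exists_eq_add_of_le' (show 1 ≤ M by omega)
    have h1 : ∑ i ∈ Finset.Icc (r + 1) (M + 1),
        (-1 : ℤ) ^ (i - (r + 1)) * (i - 1).choose (r + 1 - 1) * e.choose (i - 1) =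
        if e = r then 1 else 0 := by
      rw [← sum_neg_one_pow_mul_choose_mul_choose_of_le (r := r) (show e ≤ M by omega),
        ← Finset.map_add_right_Icc, Finset.sum_map]
      refine Finset.sum_congr rfl fun i _ => ?_
      simp
    have h2 := congrArg₂ (· + ·) (ih (by omega)) h1
    simp only [← Finset.sum_add_distrib] at h2
    rw [show (if r + 1 ≤ e + 1 then (1 : ℤ) else 0) =
      (if r + 1 ≤ e then 1 else 0) + if e = r then 1 else 0 by split_ifs <;> omega, ← h2]
    refine Finset.sum_congr rfl fun i hi => ?_
    rw [Finset.mem_Icc] at hi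
    obtain ⟨i, rfl⟩ := Nat.exists_eq_add_of_le' (show 1 ≤ i by omega)
    rw [Nat.choose_succ_succ]
    push_cast
    simp
    ring

/-! ### Subgraphs of the coprimality graph -/

open Classical in
/-- A graph with `e` edges has `e.choose i` spanning subgraphs with `i` edges. -/
theorem card_filter_le_and_ncard_edgeSet_eq {V : Type*} [Fintype V] (H : SimpleGraph V) (i : ℕ) :
    ((Finset.univ : Finset (SimpleGraph V)).filter
      fun G => G ≤ H ∧ G.edgeSet.ncard = i).card = H.edgeSet.ncard.choose i := by
  rw [Set.ncard_eq_toFinset_card', ← Finset.card_powersetCard]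
  refine Finset.card_bij (fun G _ => G.edgeSet.toFinset) ?_ ?_ ?_
  · intro G hG
    simp only [Finset.mem_filter, Finset.mem_univ, true_and] at hG
    rw [Finset.mem_powersetCard, Set.toFinset_subset_toFinset, ← Set.ncard_eq_toFinset_card']
    exact ⟨SimpleGraph.edgeSet_mono hG.1, hG.2⟩
  · intro G _ G' _ h
    exact SimpleGraph.edgeSet_injective (Set.toFinset_inj.1 h)
  · intro s hs
    rw [Finset.mem_powersetCard] at hs
    have hsub : (s : Set (Sym2 V)) ⊆ H.edgeSet := fun x hx => Set.mem_toFinset.1 (hs.1 hx)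
    have hedge : (SimpleGraph.fromEdgeSet (s : Set (Sym2 V))).edgeSet = s := by
      -- `fromEdgeSet` discards diagonal pairs; edges of H include none.
      rw [SimpleGraph.edgeSet_fromEdgeSet, sdiff_eq_left, Set.disjoint_left]
      intro x hx hd
      exact H.not_isDiag_of_mem_edgeSet (hsub hx) hd
    refine ⟨SimpleGraph.fromEdgeSet s, ?_, ?_⟩
    · simp only [Finset.mem_filter, Finset.mem_univ, true_and]
      refine ⟨?_, ?_⟩
      · rw [← SimpleGraph.edgeSet_subset_edgeSet, hedge]
        exact hsub
      · rw [hedge, Set.ncard_coe_finset, hs.2]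
    · ext x
      exact (@Set.mem_toFinset _ _ (_) x).trans (Set.ext_iff.1 hedge x)

/-- The graph joining two distinct indices if the corresponding entries are coprime. -/
def coprimeGraph {k : ℕ} (a : Fin k → ℕ) : SimpleGraph (Fin k) where
  Adj i j := i ≠ j ∧ Nat.Coprime (a i) (a j)
  symm := ⟨fun _ _ h => ⟨h.1.symm, h.2.symm⟩⟩
  loopless := ⟨fun _ h => h.1 rfl⟩

theorem isGraphwiseCoprime_iff_le_coprimeGraph {k : ℕ} (G : SimpleGraph (Fin k)) (a : Fin k → ℕ) :
    IsGraphwiseCoprime G a ↔ G ≤ coprimeGraph a :=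
  ⟨fun h i j hij => ⟨hij.ne, h i j hij⟩, fun h _ _ hij => (h hij).2⟩

theorem coprimePairs_eq_ncard_edgeSet {k : ℕ} (a : Fin k → ℕ) :
    coprimePairs a = (coprimeGraph a).edgeSet.ncard := by
  classical
  rw [Set.ncard_eq_toFinset_card', coprimePairs]
  refine Finset.card_bij (fun e _ => s(e.1, e.2)) ?_ ?_ ?_
  · intro e he
    simp only [Finset.mem_filter, Finset.mem_univ, true_and] at he
    rw [Set.mem_toFinset, SimpleGraph.mem_edgeSet]
    exact ⟨he.1.ne, he.2⟩
  · rintro ⟨i, j⟩ hij ⟨i', j'⟩ hij' h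
    simp only [Finset.mem_filter, Finset.mem_univ, true_and] at hij hij'
    rcases Sym2.eq_iff.1 h with ⟨rfl, rfl⟩ | ⟨rfl, rfl⟩
    · rfl
    · exact absurd hij.1 hij'.1.asymm
  · intro s hs
    induction s using Sym2.ind with
    | _ i j =>
      rw [Set.mem_toFinset, SimpleGraph.mem_edgeSet] at hs
      rcases lt_or_gt_of_ne hs.1 with h | h
      · exact ⟨(i, j), by simpa [h] using hs.2, rfl⟩
      · exact ⟨(j, i), by simpa [h] using hs.2.symm, Sym2.eq_swap⟩

theorem coprimePairs_le {k : ℕ} (a : Fin k → ℕ) : coprimePairs a ≤ k * (k - 1) / 2 := by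
  classical
  rw [coprimePairs_eq_ncard_edgeSet, Set.ncard_eq_toFinset_card', ← Nat.choose_two_right]
  simpa [SimpleGraph.edgeFinset] using (coprimeGraph a).card_edgeFinset_le_card_choose_two

theorem tupleCount_eq_sum (k : ℕ) (P : (Fin k → ℕ) → Prop) [DecidablePred P] (n : ℕ) :
    (tupleCount k P n : ℝ) =
      ∑ a ∈ Fintype.piFinset fun _ : Fin k => Finset.Icc 1 n, if P a then 1 else 0 := by
  rw [tupleCount_eq_card, Finset.sum_boole]

/-- If the indicator of `P` is a linear combination of the numbers of `i`-edge graphs `G` for which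
the tuple is `G`-wise coprime, then the probability of `P` is the corresponding linear combination
of the `B_{k,i}`. -/
theorem hasProbability_of_indicator_eq_sum {k : ℕ} {P : (Fin k → ℕ) → Prop} [DecidablePred P]
    (I : Finset ℕ) (w : ℕ → ℤ)
    (hG : ∀ G : SimpleGraph (Fin k),
      HasProbability k (fun a => IsGraphwiseCoprime G a) (graphConst G))
    (hP : ∀ a, (if P a then (1 : ℤ) else 0) = ∑ i ∈ I, w i * (coprimePairs a).choose i) :
    HasProbability k P (∑ i ∈ I, (w i : ℝ) * graphConstSum k i) := by
  classical
  have hlim : Tendsto (fun n : ℕ => ∑ i ∈ I, (w i : ℝ) *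
      ∑ G ∈ (Finset.univ : Finset (SimpleGraph (Fin k))).filter (fun G => G.edgeSet.ncard = i),
        (tupleCount k (fun a => IsGraphwiseCoprime G a) n : ℝ) / (n : ℝ) ^ k) atTop
      (𝓝 (∑ i ∈ I, (w i : ℝ) * graphConstSum k i)) := by
    refine tendsto_finsetSum _ fun i _ => Tendsto.const_mul _ ?_
    unfold graphConstSum
    convert tendsto_finsetSum _ fun G _ => hG G
  refine hlim.congr fun n => ?_
  simp_rw [← Finset.sum_div, ← mul_div_assoc, ← Finset.sum_div]
  congr 1
  simp_rw [tupleCount_eq_sum]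
  have hP' : ∀ a, (if P a then (1 : ℝ) else 0) =
      ∑ i ∈ I, (w i : ℝ) * (coprimePairs a).choose i := by
    intro a
    exact_mod_cast congrArg (Int.cast : ℤ → ℝ) (hP a)
  simp_rw [hP']
  rw [Finset.sum_comm]
  refine Finset.sum_congr rfl fun i _ => ?_
  rw [← Finset.mul_sum, Finset.sum_comm]
  congr 1
  refine Finset.sum_congr rfl fun a _ => ?_
  -- Double counting: for a fixed tuple, both sides count the i-edge subgraphs of its coprimality
  -- graph.
  rw [coprimePairs_eq_ncard_edgeSet, ← card_filter_le_and_ncard_edgeSet_eq, Finset.sum_boole,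
    Finset.filter_filter]
  simp_rw [isGraphwiseCoprime_iff_le_coprimeGraph, and_comm]
  congr!

/-! ### The Euler factors as proportions -/

instance neZero_coe_primes (p : Nat.Primes) : NeZero (p : ℕ) := ⟨p.2.ne_zero⟩

open Classical in
theorem eulerFactor_eq_sum_indepSet {k : ℕ} (G : SimpleGraph (Fin k)) (p : Nat.Primes) :
    eulerFactor G p = ∑ s ∈ (Finset.univ : Finset (Finset (Fin k))).filter
      (fun s : Finset (Fin k) => G.IsIndepSet (s : Set (Fin k))),
      (1 - 1 / ((p : ℕ) : ℝ)) ^ (k - s.card) * (1 / ((p : ℕ) : ℝ) ^ s.card) := by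
  rw [← Finset.sum_fiberwise_of_maps_to (g := Finset.card) (t := Finset.range (k + 1))]
  · refine Finset.sum_congr rfl fun m _ => ?_
    rw [Finset.sum_congr rfl (g := fun _ =>
      (1 - 1 / ((p : ℕ) : ℝ)) ^ (k - m) * (1 / ((p : ℕ) : ℝ) ^ m)), Finset.sum_const, nsmul_eq_mul,
      mul_assoc, indepCount, Set.ncard_eq_toFinset_card']
    · congr 3
      ext s
      simp [SimpleGraph.isNIndepSet_iff]
    · intro s hs
      rw [(Finset.mem_filter.1 hs).2]
  · intro s _
    have := s.card_le_univ
    rw [Fintype.card_fin] at this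
    exact Finset.mem_range.2 (by omega)

open Classical in
/-- The number of tuples modulo `q` with a given set of vanishing entries. -/
theorem card_filter_zeroSet_eq {k : ℕ} (q : ℕ) [NeZero q] (s : Finset (Fin k)) :
    ((Finset.univ : Finset (Fin k → ZMod q)).filter
      fun x => (Finset.univ.filter fun i => x i = 0) = s).card = (q - 1) ^ (k - s.card) := by
  have h : (Finset.univ : Finset (Fin k → ZMod q)).filter
      (fun x => (Finset.univ.filter fun i => x i = 0) = s) =
      Fintype.piFinset fun i => if i ∈ s then {0} else {0}ᶜ := by
    ext x
    simp only [Finset.mem_filter, Finset.mem_univ, true_and, Fintype.mem_piFinset, Finset.ext_iff]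
    refine forall_congr' fun i => ?_
    split_ifs with hi <;> simp [hi]
  rw [h, Fintype.card_piFinset]
  simp only [apply_ite Finset.card, Finset.card_singleton, Finset.card_compl, ZMod.card]
  rw [Finset.prod_ite, Finset.prod_const_one, one_mul, Finset.prod_const, Finset.filter_not,
    Finset.filter_mem_eq_inter, Finset.univ_inter, ← Finset.compl_eq_univ_sdiff, Finset.card_compl,
    Fintype.card_fin]

open Classical in
/-- The Euler factor at `p` is the proportion of tuples modulo `p` without two vanishing entries at
the ends of an edge. -/
theorem eulerFactor_eq_card_div {k : ℕ} (G : SimpleGraph (Fin k)) (p : Nat.Primes) :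
    eulerFactor G p = (((Finset.univ : Finset (Fin k → ZMod p)).filter
      fun x => ∀ i j, G.Adj i j → ¬(x i = 0 ∧ x j = 0)).card : ℝ) / ((p : ℕ) : ℝ) ^ k := by
  have hp : ((p : ℕ) : ℝ) ≠ 0 := NeZero.ne _
  rw [eulerFactor_eq_sum_indepSet, eq_div_iff (pow_ne_zero _ hp), Finset.sum_mul,
    Finset.card_eq_sum_card_fiberwise (f := fun x => Finset.univ.filter fun i => x i = 0)
      (t := (Finset.univ : Finset (Finset (Fin k))).filter
        (fun s : Finset (Fin k) => G.IsIndepSet (s : Set (Fin k)))), Nat.cast_sum]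
  · refine Finset.sum_congr rfl fun s hs => ?_
    rw [Finset.mem_filter] at hs
    rw [Finset.filter_filter, Finset.filter_congr (q := fun x : Fin k → ZMod p =>
      (Finset.univ.filter fun i => x i = 0) = s), card_filter_zeroSet_eq]
    · have hsk : s.card ≤ k := by simpa using s.card_le_univ
      have hpow : ((p : ℕ) : ℝ) ^ k = ((p : ℕ) : ℝ) ^ (k - s.card) * ((p : ℕ) : ℝ) ^ s.card := by
        rw [← pow_add, Nat.sub_add_cancel hsk]
      rw [hpow, Nat.cast_pow, Nat.cast_sub p.2.one_le, Nat.cast_one,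
        show ((p : ℕ) : ℝ) - 1 = (1 - 1 / ((p : ℕ) : ℝ)) * ((p : ℕ) : ℝ) by field_simp, mul_pow]
      field_simp
    · intro x _
      refine and_iff_right_of_imp fun h i j hij hx => ?_
      subst h
      exact hs.2 (by simpa using hx.1) (by simpa using hx.2) hij.ne hij
  · intro x hx
    simp only [Finset.coe_filter, Finset.mem_univ, true_and, Set.mem_ofPred_eq] at hx ⊢
    intro i hi j hj _ hij
    exact hx i j hij ⟨by simpa using hi, by simpa using hj⟩

open Classical in
-- Union bound over at most k^2 ordered adjacent pairs, each vanishing modulo p with probability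
-- 1/p^2.
theorem abs_eulerFactor_sub_one_le {k : ℕ} (G : SimpleGraph (Fin k)) (p : Nat.Primes) :
    |eulerFactor G p - 1| ≤ k ^ 2 * (1 / ((p : ℕ) : ℝ) ^ 2) := by
  have hp : (0 : ℝ) < ((p : ℕ) : ℝ) := by exact_mod_cast p.2.pos
  have hpk := pow_pos hp k
  set good := (Finset.univ : Finset (Fin k → ZMod p)).filter
      fun x => ∀ i j, G.Adj i j → ¬(x i = 0 ∧ x j = 0) with hgood
  set bad := (Finset.univ : Finset (Fin k → ZMod p)).filter
      fun x => ¬ ∀ i j, G.Adj i j → ¬(x i = 0 ∧ x j = 0) with hbad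
  have htotal : (good.card : ℝ) + bad.card = ((p : ℕ) : ℝ) ^ k := by
    have := Finset.card_filter_add_card_filter_not (s := (Finset.univ : Finset (Fin k → ZMod p)))
      (fun x => ∀ i j, G.Adj i j → ¬(x i = 0 ∧ x j = 0))
    rw [Finset.card_univ, Fintype.card_fun, ZMod.card, Fintype.card_fin] at this
    exact_mod_cast this
  have hpair : ∀ e ∈ (Finset.univ : Finset (Fin k × Fin k)).filter (fun e => G.Adj e.1 e.2),
      (((Finset.univ : Finset (Fin k → ZMod p)).filter
        fun x => x e.1 = 0 ∧ x e.2 = 0).card : ℝ) ≤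
        ((p : ℕ) : ℝ) ^ k * (1 / ((p : ℕ) : ℝ) ^ 2) := by
    intro e he
    rw [Finset.mem_filter] at he
    have := card_piFinset_filter_and_mul_sq (Finset.univ : Finset (ZMod p)) (· = 0) he.2.ne
    have hzero : ((Finset.univ : Finset (ZMod p)).filter (· = 0)).card = 1 := by
      rw [Finset.filter_eq' Finset.univ, if_pos (Finset.mem_univ _), Finset.card_singleton]
    rw [hzero, Fintype.piFinset_univ, Finset.card_univ, ZMod.card, Fintype.card_fin, one_pow,
      one_mul] at this
    rw [mul_one_div, le_div_iff₀ (by positivity)]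
    exact_mod_cast this.le
  have hb : (bad.card : ℝ) ≤ k ^ 2 * (((p : ℕ) : ℝ) ^ k * (1 / ((p : ℕ) : ℝ) ^ 2)) := by
    have hsub : bad ⊆ ((Finset.univ : Finset (Fin k × Fin k)).filter
        (fun e => G.Adj e.1 e.2)).biUnion fun e =>
          (Finset.univ : Finset (Fin k → ZMod p)).filter fun x => x e.1 = 0 ∧ x e.2 = 0 := by
      intro x hx
      simp only [hbad, Finset.mem_filter, Finset.mem_univ, true_and] at hx
      push Not at hx
      obtain ⟨i, j, hij, hx⟩ := hx
      simp only [Finset.mem_biUnion, Finset.mem_filter, Finset.mem_univ, true_and]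
      exact ⟨(i, j), hij, hx⟩
    calc (bad.card : ℝ) ≤ ∑ e ∈ (Finset.univ : Finset (Fin k × Fin k)).filter
            (fun e => G.Adj e.1 e.2), (((Finset.univ : Finset (Fin k → ZMod p)).filter
              fun x => x e.1 = 0 ∧ x e.2 = 0).card : ℝ) := by
          exact_mod_cast (Finset.card_le_card hsub).trans Finset.card_biUnion_le
      _ ≤ _ := Finset.sum_le_card_nsmul _ _ _ hpair
      _ ≤ _ := by
          rw [nsmul_eq_mul]
          gcongr
          have := ((Finset.univ : Finset (Fin k × Fin k)).filter
            (fun e => G.Adj e.1 e.2)).card_le_univ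
          rw [Fintype.card_prod, Fintype.card_fin, ← sq] at this
          exact_mod_cast this
  rw [eulerFactor_eq_card_div, div_sub_one hpk.ne', ← hgood, ← htotal, sub_add_cancel_left, abs_div,
    abs_neg, Nat.abs_cast, htotal, abs_of_pos hpk, div_le_iff₀ hpk]
  linarith

theorem summable_one_div_primes_sq : Summable fun p : Nat.Primes => 1 / ((p : ℕ) : ℝ) ^ 2 :=
  (Real.summable_one_div_nat_pow.2 one_lt_two).comp_injective
    (i := fun p : Nat.Primes => (p : ℕ)) Subtype.val_injective

theorem multipliable_eulerFactor {k : ℕ} (G : SimpleGraph (Fin k)) :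
    Multipliable (eulerFactor G) := by
  have h := multipliable_one_add_of_summable (f := fun p => eulerFactor G p - 1)
    (.of_nonneg_of_le (fun _ => norm_nonneg _) (abs_eulerFactor_sub_one_le G)
      (summable_one_div_primes_sq.mul_left _))
  simpa using h

/-! ### Sieving by finitely many primes -/

/-- No prime in `s` divides two entries of `a` at the ends of an edge. -/
def IsGraphwiseCoprimeAt {k : ℕ} (s : Finset Nat.Primes) (G : SimpleGraph (Fin k))
    (a : Fin k → ℕ) : Prop :=
  ∀ p ∈ s, ∀ i j, G.Adj i j → ¬(((p : ℕ) ∣ a i) ∧ (p : ℕ) ∣ a j)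

theorem hasProbability_isGraphwiseCoprimeAt {k : ℕ} (s : Finset Nat.Primes)
    (G : SimpleGraph (Fin k)) :
    HasProbability k (IsGraphwiseCoprimeAt s G) (∏ p ∈ s, eulerFactor G p) := by
  have hq : Pairwise (Function.onFun Nat.Coprime fun p : s => ((p : Nat.Primes) : ℕ)) := by
    intro p q hpq
    exact (Nat.coprime_primes p.1.2 q.1.2).2 fun h => hpq (Subtype.ext (Subtype.ext h))
  have h := hasProbability_forall_cast (fun p : s => ((p : Nat.Primes) : ℕ)) hq k
    fun p x => ∀ i j, G.Adj i j → ¬(x i = 0 ∧ x j = 0)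
  rw [← Finset.prod_coe_sort]
  simp_rw [eulerFactor_eq_card_div]
  convert h using 2 with a
  · simp [IsGraphwiseCoprimeAt, ZMod.natCast_eq_zero_iff]
  · congr!

open Classical in
theorem card_filter_dvd_and_dvd_div_le {k : ℕ} {i j : Fin k} (hij : i ≠ j) (n : ℕ) {p : ℕ}
    (hp : 0 < p) :
    (((Fintype.piFinset fun _ : Fin k => Finset.Icc 1 n).filter
      fun a => p ∣ a i ∧ p ∣ a j).card : ℝ) ≤ (n : ℝ) ^ k * (1 / (p : ℝ) ^ 2) := by
  rcases Nat.eq_zero_or_pos n with rfl | hn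
  · rw [Finset.Icc_eq_empty (by omega), Finset.card_eq_zero.2]
    · simp only [Nat.cast_zero]
      positivity
    · refine Finset.filter_eq_empty_iff.2 fun a ha => ?_
      exact absurd (Fintype.mem_piFinset.1 ha i) (Finset.notMem_empty _)
  have h := card_piFinset_filter_and_mul_sq (Finset.Icc 1 n) (p ∣ ·) hij
  have hdvd : ((Finset.Icc 1 n).filter (p ∣ ·)).card = n / p := by
    rw [← Nat.Ioc_filter_dvd_card_eq_div]
    rfl
  rw [hdvd, Nat.card_Icc, Nat.add_sub_cancel, Fintype.card_fin] at h
  have hle : (((n / p : ℕ) : ℝ)) ^ 2 ≤ ((n : ℝ) / p) ^ 2 := by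
    gcongr
    exact Nat.cast_div_le
  have hn' : (0 : ℝ) < (n : ℝ) ^ 2 := by positivity
  refine le_of_mul_le_mul_right ?_ hn'
  calc _ = ((n / p : ℕ) : ℝ) ^ 2 * (n : ℝ) ^ k := by exact_mod_cast h
    _ ≤ ((n : ℝ) / p) ^ 2 * (n : ℝ) ^ k := by gcongr
    _ = _ := by
      rw [div_pow]
      ring

theorem tupleCount_mono {k : ℕ} {P Q : (Fin k → ℕ) → Prop} (h : ∀ a, P a → Q a) (n : ℕ) :
    tupleCount k P n ≤ tupleCount k Q n := by
  classical
  rw [tupleCount_eq_card, tupleCount_eq_card]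
  exact Finset.card_le_card (Finset.monotone_filter_right _ fun a _ => h a)

theorem IsGraphwiseCoprime.isGraphwiseCoprimeAt {k : ℕ} {G : SimpleGraph (Fin k)} {a : Fin k → ℕ}
    (h : IsGraphwiseCoprime G a) (s : Finset Nat.Primes) : IsGraphwiseCoprimeAt s G a :=
  fun p _ i j hij hp => Nat.not_coprime_of_dvd_of_dvd p.2.one_lt hp.1 hp.2 (h i j hij)

/-- The tuples that pass the sieve by the primes in `s` without being `G`-wise coprime are few. -/
theorem tupleCount_isGraphwiseCoprimeAt_le {k : ℕ} (s : Finset Nat.Primes)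
    (G : SimpleGraph (Fin k)) {ε : ℝ}
    (hs : ∀ t : Finset Nat.Primes, Disjoint t s → ∑ p ∈ t, 1 / ((p : ℕ) : ℝ) ^ 2 ≤ ε) (n : ℕ) :
    (tupleCount k (IsGraphwiseCoprimeAt s G) n : ℝ) ≤
      tupleCount k (fun a => IsGraphwiseCoprime G a) n + k ^ 2 * ((n : ℝ) ^ k * ε) := by
  classical
  set X := Fintype.piFinset fun _ : Fin k => Finset.Icc 1 n with hX
  -- A prime dividing an entry is at most n, so only finitely many primes outside s can matter.
  let t : Finset Nat.Primes := ((Finset.Icc 1 n).subtype Nat.Prime : Finset {q // Nat.Prime q}) \ s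
  set E := (Finset.univ : Finset (Fin k × Fin k)).filter (fun e => G.Adj e.1 e.2) with hE
  have hsub : X.filter (IsGraphwiseCoprimeAt s G) ⊆ X.filter (fun a => IsGraphwiseCoprime G a) ∪
      E.biUnion fun e => t.biUnion fun p =>
        X.filter fun a => (p : ℕ) ∣ a e.1 ∧ (p : ℕ) ∣ a e.2 := by
    intro a ha
    rw [Finset.mem_filter] at ha
    rw [Finset.mem_union]
    by_cases h : IsGraphwiseCoprime G a
    · exact Or.inl (Finset.mem_filter.2 ⟨ha.1, h⟩)
    right
    unfold IsGraphwiseCoprime at h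
    push Not at h
    obtain ⟨i, j, hij, h⟩ := h
    obtain ⟨p, hp, hpi, hpj⟩ := Nat.Prime.not_coprime_iff_dvd.1 h
    simp only [Finset.mem_biUnion]
    refine ⟨(i, j), by simp [hE, hij], ⟨p, hp⟩, ?_, by simp [ha.1, hpi, hpj]⟩
    refine Finset.mem_sdiff.2 ⟨?_, fun hps => ha.2 _ hps i j hij ⟨hpi, hpj⟩⟩
    have hai := Finset.mem_Icc.1 (Fintype.mem_piFinset.1 ha.1 i)
    refine (Finset.mem_subtype (p := Nat.Prime) (a := ⟨p, hp⟩)).2 (Finset.mem_Icc.2 ?_)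
    exact ⟨hp.one_le, (Nat.le_of_dvd hai.1 hpi).trans hai.2⟩
  have hcard := (Finset.card_le_card hsub).trans (Finset.card_union_le _ _)
  rw [← tupleCount_eq_card, ← tupleCount_eq_card] at hcard
  have hε : 0 ≤ ε := by simpa using hs ∅ (Finset.disjoint_empty_left _)
  have hbound : ((E.biUnion fun e => t.biUnion fun p =>
      X.filter fun a => (p : ℕ) ∣ a e.1 ∧ (p : ℕ) ∣ a e.2).card : ℝ) ≤
      k ^ 2 * ((n : ℝ) ^ k * ε) := by
    calc _ ≤ ∑ e ∈ E, ((t.biUnion fun p =>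
          X.filter fun a => (p : ℕ) ∣ a e.1 ∧ (p : ℕ) ∣ a e.2).card : ℝ) := by
          exact_mod_cast Finset.card_biUnion_le
      _ ≤ E.card • ((n : ℝ) ^ k * ε) := by
          refine Finset.sum_le_card_nsmul _ _ _ fun e he => ?_
          calc _ ≤ ∑ p ∈ t, ((X.filter fun a => (p : ℕ) ∣ a e.1 ∧ (p : ℕ) ∣ a e.2).card : ℝ) := by
                exact_mod_cast Finset.card_biUnion_le
            _ ≤ ∑ p ∈ t, (n : ℝ) ^ k * (1 / ((p : ℕ) : ℝ) ^ 2) :=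
                Finset.sum_le_sum fun p _ =>
                  card_filter_dvd_and_dvd_div_le (Finset.mem_filter.1 he).2.ne n p.2.pos
            _ ≤ _ := by
                rw [← Finset.mul_sum]
                gcongr
                exact hs t Finset.sdiff_disjoint
      _ ≤ _ := by
          rw [nsmul_eq_mul]
          gcongr
          have := E.card_le_univ
          rw [Fintype.card_prod, Fintype.card_fin, ← sq] at this
          exact_mod_cast this
  have hcard' : (tupleCount k (IsGraphwiseCoprimeAt s G) n : ℝ) ≤
      tupleCount k (fun a => IsGraphwiseCoprime G a) n + ((E.biUnion fun e => t.biUnion fun p =>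
        X.filter fun a => (p : ℕ) ∣ a e.1 ∧ (p : ℕ) ∣ a e.2).card : ℝ) := by
    exact_mod_cast hcard
  exact hcard'.trans (by gcongr)

/-- The probability of being `G`-wise relatively prime is the Euler product `A_G`. -/
theorem hasProbability_isGraphwiseCoprime {k : ℕ} (G : SimpleGraph (Fin k)) :
    HasProbability k (fun a => IsGraphwiseCoprime G a) (graphConst G) := by
  refine Metric.tendsto_atTop'.2 fun ε hε => ?_
  -- The `+ 1` keeps the denominator positive when k = 0.
  let δ : ℝ := ε / 3 / (k ^ 2 + 1)
  have hδ : 0 < δ := by positivity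
  have hkδ : (k : ℝ) ^ 2 * δ ≤ ε / 3 := by
    rw [← mul_div_assoc, div_le_iff₀ (by positivity)]
    nlinarith
  obtain ⟨s₀, hs₀⟩ := summable_iff_vanishing_norm.1 summable_one_div_primes_sq δ hδ
  have hprod : Tendsto (fun s : Finset Nat.Primes => ∏ p ∈ s, eulerFactor G p) atTop
      (𝓝 (graphConst G)) := (multipliable_eulerFactor G).hasProd
  -- One finite s serves twice: its partial product is close to A_G, and its tail of ∑ 1/p^2 is
  -- small. The sieve density supplies the remaining ε / 3.
  obtain ⟨s, hs, hss₀⟩ := ((Metric.tendsto_nhds.1 hprod (ε / 3) (by positivity)).and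
    (eventually_ge_atTop s₀)).exists
  have htail : ∀ t : Finset Nat.Primes, Disjoint t s → ∑ p ∈ t, 1 / ((p : ℕ) : ℝ) ^ 2 ≤ δ :=
    fun t ht => (le_abs_self _).trans (hs₀ t (ht.mono_right hss₀)).le
  have hlim := Metric.tendsto_nhds.1 (hasProbability_isGraphwiseCoprimeAt s G) (ε / 3)
    (by positivity)
  obtain ⟨N, hN⟩ := eventually_atTop.1 (hlim.and (eventually_gt_atTop 0))
  refine ⟨N, fun n hn => ?_⟩
  obtain ⟨h1, hn0⟩ := hN n hn.le
  have hnk : (0 : ℝ) < (n : ℝ) ^ k := by positivity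
  have h2 : (tupleCount k (fun a => IsGraphwiseCoprime G a) n : ℝ) / (n : ℝ) ^ k ≤
      (tupleCount k (IsGraphwiseCoprimeAt s G) n : ℝ) / (n : ℝ) ^ k := by
    gcongr
    exact tupleCount_mono (fun a ha => ha.isGraphwiseCoprimeAt s) n
  have h3 : (tupleCount k (IsGraphwiseCoprimeAt s G) n : ℝ) / (n : ℝ) ^ k ≤
      (tupleCount k (fun a => IsGraphwiseCoprime G a) n : ℝ) / (n : ℝ) ^ k + k ^ 2 * δ := by
    rw [div_add' _ _ _ hnk.ne']
    gcongr
    refine (tupleCount_isGraphwiseCoprimeAt_le s G htail n).trans_eq ?_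
    ring
  rw [Real.dist_eq, abs_lt] at h1 hs ⊢
  constructor <;> linarith [h1.1, h1.2, hs.1, hs.2]

/-! ### Probabilities for the number of coprime pairs -/

theorem coprimePairs_eq_zero_iff {k : ℕ} (a : Fin k → ℕ) :
    coprimePairs a = 0 ↔ ∀ i j : Fin k, i ≠ j → ¬ Nat.Coprime (a i) (a j) := by
  rw [coprimePairs, Finset.card_eq_zero, Finset.filter_eq_empty_iff]
  constructor
  · intro h i j hij hc
    rcases lt_or_gt_of_ne hij with hlt | hlt
    · exact h (Finset.mem_univ (i, j)) ⟨hlt, hc⟩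
    · exact h (Finset.mem_univ (j, i)) ⟨hlt, hc.symm⟩
  · intro h e _ he
    exact h _ _ he.1.ne he.2

theorem corollary3 (k : ℕ) :
    (∀ G : SimpleGraph (Fin k),
      Multipliable (eulerFactor G) ∧
        HasProbability k (fun a => IsGraphwiseCoprime G a) (graphConst G)) ∧
    (∀ r : ℕ,
      HasProbability k (fun a => coprimePairs a = r)
        (∑ i ∈ Finset.Icc r (k * (k - 1) / 2),
          (-1 : ℝ) ^ (i - r) * (i.choose r : ℝ) * graphConstSum k i)) ∧
    (∀ r : ℕ, 1 ≤ r →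
      HasProbability k (fun a => r ≤ coprimePairs a)
        (∑ i ∈ Finset.Icc r (k * (k - 1) / 2),
          (-1 : ℝ) ^ (i - r) * ((i - 1).choose (r - 1) : ℝ) * graphConstSum k i)) ∧
    HasProbability k (fun a => ∀ i j : Fin k, i ≠ j → ¬ Nat.Coprime (a i) (a j))
      (∑ i ∈ Finset.Icc 0 (k * (k - 1) / 2), (-1 : ℝ) ^ i * graphConstSum k i) := by
  classical
  have hexact : ∀ r : ℕ, HasProbability k (fun a => coprimePairs a = r)
      (∑ i ∈ Finset.Icc r (k * (k - 1) / 2),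
        (-1 : ℝ) ^ (i - r) * (i.choose r : ℝ) * graphConstSum k i) := by
    intro r
    have h := hasProbability_of_indicator_eq_sum (P := fun a => coprimePairs a = r)
      (Finset.Icc r (k * (k - 1) / 2)) (fun i => (-1) ^ (i - r) * i.choose r)
      hasProbability_isGraphwiseCoprime
      fun a => by rw [sum_neg_one_pow_mul_choose_mul_choose_of_le (coprimePairs_le a)]
    push_cast at h
    exact h
  refine ⟨fun G => ⟨multipliable_eulerFactor G, hasProbability_isGraphwiseCoprime G⟩, hexact, ?_, ?_⟩
  · intro r hr
    -- Since i ≥ r ≥ 1, the subtractions `i - 1` and `r - 1` are never truncated.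
    have h := hasProbability_of_indicator_eq_sum (P := fun a => r ≤ coprimePairs a)
      (Finset.Icc r (k * (k - 1) / 2)) (fun i => (-1) ^ (i - r) * (i - 1).choose (r - 1))
      hasProbability_isGraphwiseCoprime
      fun a => by rw [sum_neg_one_pow_mul_choose_pred_mul_choose_of_le hr (coprimePairs_le a)]
    push_cast at h
    exact h
  · simpa [coprimePairs_eq_zero_iff] using hexact 0
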